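/- Let $k$ be an algebraically closed field and $R = k[x,y,z]$ with the standard grading. For a reduced plane projective curve $F \subset \mathbb{P}^2$, given by a squarefree homogeneous polynomial $F \in R$ of degree $d+1 \ge 1$ with $\operatorname{char}(k) \nmid d+1$, let $$\mathrm{Syz}(J_F) = \{(a,b,c) \in R^3 : aF_x + bF_y + cF_z = 0\}$$ be the graded module of first syzygies of its Jacobian ideal, and let $\epsilon$ be a minimal syzygy, that is, a nonzero homogeneous element of $\mathrm{Syz}(J_F)$ of the least possible degree $e$. A Bourbaki ideal of $F$ is an ideal $I_\epsilon \subseteq R$ with a graded isomorphism $\mathrm{Syz}(J_F)/R\epsilon \cong I_\epsilon(e-d)$, and the Bourbaki degree $\mathrm{Bour}(F)$ is the degree of $R/I_\epsilon$ (read off from its Hilbert polynomial; it is $0$ if $I_\epsilon = R$). For every natural number $n \ge 0$ there exists such a curve $F$ with $\mathrm{Bour}(F) = n$; that is, $F$ has a Bourbaki ideal, and $\deg(R/I_\epsilon) = n$ for every choice of $\epsilon$ and $I_\epsilon$. -/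

import Mathlib

namespace BourbakiDegree

open MvPolynomial

variable {k : Type*} [Field k]

/-- The module of first syzygies of the Jacobian ideal of `F`: all `(a, b, c)` with
`a F_x + b F_y + c F_z = 0`. -/
def jacobianSyzygies (F : MvPolynomial (Fin 3) k) :
    Submodule (MvPolynomial (Fin 3) k) (Fin 3 → MvPolynomial (Fin 3) k) where
  carrier := {u | ∑ i, u i * pderiv i F = 0}
  zero_mem' := by simp
  add_mem' := by
    intro u v hu hv
    simp only [Set.mem_ofPred_eq, Pi.add_apply, add_mul, Finset.sum_add_distrib] at *
    rw [hu, hv, add_zero]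
  smul_mem' := by
    intro c u hu
    simp only [Set.mem_ofPred_eq, Pi.smul_apply, smul_eq_mul, mul_assoc] at *
    rw [← Finset.mul_sum, hu, mul_zero]

/-- A syzygy is homogeneous of degree `j` when its three entries are forms of degree `j`. -/
def IsHomogeneousSyzygy {F : MvPolynomial (Fin 3) k} (u : jacobianSyzygies F) (j : ℕ) : Prop :=
  ∀ i, (u.1 i).IsHomogeneous j

/-- `ε` is a minimal syzygy of degree `e`: a nonzero homogeneous syzygy of the least degree that
occurs, i.e. the first member of a homogeneous generating set ordered by increasing degree. -/
structure IsMinimalSyzygy {F : MvPolynomial (Fin 3) k} (ε : jacobianSyzygies F) (e : ℕ) :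
    Prop where
  ne_zero : ε ≠ 0
  isHomogeneous : IsHomogeneousSyzygy ε e
  minimal : ∀ (u : jacobianSyzygies F) (j : ℕ), u ≠ 0 → IsHomogeneousSyzygy u j → e ≤ j

/-- `M_ε = Syz(J_F) / ⟨ε⟩`. -/
abbrev SyzygyQuotient {F : MvPolynomial (Fin 3) k} (ε : jacobianSyzygies F) : Type _ :=
  jacobianSyzygies F ⧸ Submodule.span (MvPolynomial (Fin 3) k) {ε}

/-- Homogeneity with an integer degree; only `0` is homogeneous of a negative degree. -/
def IsHomogeneousOfDegree (p : MvPolynomial (Fin 3) k) (i : ℤ) : Prop :=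
  ∀ m : Fin 3 →₀ ℕ, coeff m p ≠ 0 → (m.degree : ℤ) = i

/-- `I` is a Bourbaki ideal `I_ε` of the curve `F` of degree `d + 1`: for some minimal syzygy `ε`,
of degree `e`, there is a graded isomorphism `M_ε ≅ I(e - d)`. As `I(e - d)` has the degree `j` part
`I_{j + e - d}`, the isomorphism takes the class of a syzygy of degree `j` to a form of
degree `j + e - d`. -/
def IsBourbakiIdeal (d : ℕ) (F : MvPolynomial (Fin 3) k)
    (I : Ideal (MvPolynomial (Fin 3) k)) : Prop :=
  ∃ (e : ℕ) (ε : jacobianSyzygies F), IsMinimalSyzygy ε e ∧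
    ∃ φ : SyzygyQuotient ε ≃ₗ[MvPolynomial (Fin 3) k] I,
      ∀ (u : jacobianSyzygies F) (j : ℕ), IsHomogeneousSyzygy u j →
        IsHomogeneousOfDegree (φ (Submodule.Quotient.mk u) : MvPolynomial (Fin 3) k)
          ((j : ℤ) + e - d)

/-- The Hilbert function `m ↦ dim_k (R/I)_m`, where `(R/I)_m` is the image of the forms of
degree `m`. -/
noncomputable def hilbertFunction (I : Ideal (MvPolynomial (Fin 3) k)) (m : ℕ) : ℕ :=
  Module.finrank k
    ((homogeneousSubmodule (Fin 3) k m).map (Ideal.Quotient.mkₐ k I).toLinearMap)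

/-- `P` is the Hilbert polynomial of `R/I`. -/
def IsHilbertPolynomial (I : Ideal (MvPolynomial (Fin 3) k)) (P : Polynomial ℚ) : Prop :=
  ∀ᶠ m : ℕ in Filter.atTop, (hilbertFunction I m : ℚ) = P.eval (m : ℚ)

/-- `deg (R/I) = n`. The degree of `R/I` is `r!` times the leading coefficient of its Hilbert
polynomial, if that is nonzero of degree `r`; if it is zero, the degree is the length of `R/I`
(which is `0` for `I = R`). -/
def HasDegree (I : Ideal (MvPolynomial (Fin 3) k)) (n : ℕ) : Prop :=
  ∃ P : Polynomial ℚ, IsHilbertPolynomial I P ∧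
    (P ≠ 0 → (n : ℚ) = (P.natDegree.factorial : ℚ) * P.leadingCoeff) ∧
    (P = 0 → n = Module.finrank k (MvPolynomial (Fin 3) k ⧸ I))

/-- `Bour(F) = n` for a curve `F` of degree `d + 1`: a Bourbaki ideal `I_ε` of `F` exists, and
`deg (R/I_ε) = n` whichever minimal syzygy `ε` and whichever ideal `I_ε` are taken. -/
def HasBourbakiDegree (d : ℕ) (F : MvPolynomial (Fin 3) k) (n : ℕ) : Prop :=
  (∃ I, IsBourbakiIdeal d F I) ∧ ∀ I, IsBourbakiIdeal d F I → HasDegree I n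

end BourbakiDegree

/-!
A line has Bourbaki ideal `R`, which settles `n = 0`. For `n = s > 0` let `V` be a form of degree
`s` in `y, z` alone, separable and not divisible by `z`, and consider

  `F = x z^c V^(m+1) + z^(d+1)`, where `d = c + (m+1) s`, `c ≤ 1` and `m ≥ 2`,

with `m + 1` and `d + 1` nonzero in `k`. Put `g = z^c V^m`. Then

  `F_x = g V`, `F_y = g (m+1) x V_y`, `F_z = V K + (d+1) z^d` for some `K`,

and `g` is coprime to `F_z`, so the third entry of every syzygy `u` is `q g` for some `q`, and what
remains of the syzygy relation is `u₀ V + (m+1) u₁ x V_y + q F_z = 0`. The assignment `u ↦ q`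
(`IsAdmissible.bourbakiMap`) has kernel `R ε`, where `ε = ((m+1) x V_y, -V, 0)`, because `V` is
coprime to `x V_y` (`IsAdmissible.ker_bourbakiMap`). Its image is the colon ideal
`(V, x V_y) : F_z = (V, x V_y) : z^d = (x, V)`, because `V, V_y` have no common zero off `y = z = 0`
and `(x, V)` is `z`-saturated (`IsAdmissible.range_bourbakiMap`).

Any syzygy outside `R ε` has degree at least `deg g ≥ 2s`, so `ε` is, up to constants, the only
minimal syzygy, and `e = s`. An isomorphism of `R`-modules from `(x, V)` to another ideal is
multiplication by some element of `R`, as `x` and `V` are coprime; the grading makes that element a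
constant, so `(x, V)` is the only Bourbaki ideal (`IsAdmissible.eq_of_isBourbakiIdeal`). Its Hilbert
polynomial is the constant `s`: for `V = y^s + z^(s-1) (a y + b z)` the monomials `y^i z^(j-i)`,
`i < s`, form a basis of `(R/(x, V))_j` as soon as `j ≥ s - 1`.

Such parameters exist in every characteristic: `y^s + z^s` is separable if `s ≠ 0` in `k`, and
`y^s + y z^(s-1)` is if `s = 0` in `k`. The exponent `c` is there to keep the characteristic
from dividing `d + 1`.
-/

namespace BourbakiDegree

open MvPolynomial

variable {k : Type*} [Field k]

/-! ### Homogeneous quotients -/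

/-- If a product of `h` with a nonzero form of degree `D` is a form of degree `j`, then `h` is a
form of degree `j - D`; in particular it is zero if `j < D`. -/
lemma isHomogeneousOfDegree_of_mul {h g : MvPolynomial (Fin 3) k} {D j : ℕ} (hg0 : g ≠ 0)
    (hg : g.IsHomogeneous D) (hj : (h * g).IsHomogeneous j) :
    IsHomogeneousOfDegree h ((j : ℤ) - D) := by
  intro μ hμ
  let _ := MvPolynomial.gradedAlgebra (σ := Fin 3) (R := k)
  have h1 : homogeneousComponent μ.degree h ≠ 0 := by
    intro h0
    apply hμ
    have := congrArg (coeff μ) h0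
    simpa [coeff_homogeneousComponent] using this
  have h2 : homogeneousComponent (μ.degree + D) (h * g) = homogeneousComponent μ.degree h * g := by
    have := DirectSum.coe_decompose_mul_add_of_right_mem (homogeneousSubmodule (Fin 3) k) (a := h)
      (i := μ.degree) ((mem_homogeneousSubmodule D g).2 hg)
    rwa [← decomposition.decompose'_apply, ← decomposition.decompose'_apply]
  rw [homogeneousComponent_of_mem ((mem_homogeneousSubmodule j _).2 hj)] at h2
  have h3 := mul_ne_zero h1 hg0
  split_ifs at h2 with h4
  · omega
  · exact absurd h2.symm h3

lemma IsHomogeneousOfDegree.eq_zero {h : MvPolynomial (Fin 3) k} {i : ℤ}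
    (hh : IsHomogeneousOfDegree h i) (hi : i < 0) : h = 0 := by
  ext μ
  by_contra hμ
  have := hh μ (by simpa using hμ)
  omega

lemma IsHomogeneousOfDegree.isHomogeneous {h : MvPolynomial (Fin 3) k} {i : ℕ}
    (hh : IsHomogeneousOfDegree h i) : h.IsHomogeneous i := by
  intro μ hμ
  have h1 : Finsupp.weight 1 μ = μ.degree := by
    rw [Finsupp.degree_eq_weight_one]; rfl
  rw [h1]
  exact_mod_cast hh μ hμ

lemma IsHomogeneousOfDegree.eq_C {h : MvPolynomial (Fin 3) k}
    (hh : IsHomogeneousOfDegree h 0) : ∃ r : k, h = C r := by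
  have h1 : h.IsHomogeneous 0 := IsHomogeneousOfDegree.isHomogeneous (by simpa using hh)
  exact ⟨_, totalDegree_eq_zero_iff_eq_C.1 ((totalDegree_zero_iff_isHomogeneous (Fin 3)).2 h1)⟩

lemma dvd_pderiv_of_mul_self_dvd {P F : MvPolynomial (Fin 3) k} (h : P * P ∣ F) (i : Fin 3) :
    P ∣ pderiv i F := by
  obtain ⟨Q, rfl⟩ := h
  simp only [Derivation.leibniz, smul_eq_mul]
  exact ⟨P * pderiv i Q + 2 * Q * pderiv i P, by ring⟩

/-! ### Forms in two of the variables -/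

/-- Setting the first variable to zero. -/
noncomputable def killX : MvPolynomial (Fin 3) k →ₐ[k] MvPolynomial (Fin 3) k :=
  aeval ![0, X 1, X 2]

@[simp] lemma killX_X_zero : killX (X 0 : MvPolynomial (Fin 3) k) = 0 := by simp [killX]
@[simp] lemma killX_X_one : killX (X 1 : MvPolynomial (Fin 3) k) = X 1 := by simp [killX]
@[simp] lemma killX_X_two : killX (X 2 : MvPolynomial (Fin 3) k) = X 2 := by simp [killX]

lemma X_zero_dvd_sub_killX (h : MvPolynomial (Fin 3) k) : X 0 ∣ h - killX h := by
  induction h using MvPolynomial.induction_on with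
  | C a => simp [killX]
  | add p q hp hq =>
    rw [map_add, add_sub_add_comm]
    exact dvd_add hp hq
  | mul_X p i hp =>
    have : p * X i - killX (p * X i) = (p - killX p) * X i + killX p * (X i - killX (X i)) := by
      rw [map_mul]; ring
    rw [this]
    refine dvd_add (hp.mul_right _) (Dvd.dvd.mul_left ?_ _)
    fin_cases i <;> simp

/-- `V` is a separable form of degree `s > 0` in the last two variables, not divisible by the last
one. Separability is encoded by the last variable being nilpotent modulo `V` and `V_y`. -/
structure IsSeparableBinaryForm (s : ℕ) (V : MvPolynomial (Fin 3) k) : Prop where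
  pos : 0 < s
  isHomogeneous : V.IsHomogeneous s
  killX_eq : killX V = V
  pderiv_zero : pderiv 0 V = 0
  not_dvd : ¬ X 2 ∣ V
  bezout : ∃ A B, X 2 ^ s = A * V + B * pderiv 1 V

namespace IsSeparableBinaryForm

variable {s : ℕ} {V : MvPolynomial (Fin 3) k}

lemma ne_zero (h : IsSeparableBinaryForm s V) : V ≠ 0 := by
  rintro rfl
  exact h.not_dvd (dvd_zero _)

lemma not_X_zero_dvd (h : IsSeparableBinaryForm s V) : ¬ X 0 ∣ V := by
  rintro ⟨w, hw⟩
  have := h.killX_eq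
  rw [hw, map_mul, killX_X_zero, zero_mul] at this
  exact h.ne_zero (hw.trans this.symm)

lemma not_X_two_dvd_mul_pow (h : IsSeparableBinaryForm s V) (m : ℕ) : ¬ X 2 ∣ X 0 * V ^ m := by
  intro hd
  rcases X_prime.dvd_or_dvd hd with h1 | h1
  · simp [X_dvd_X] at h1
  · exact h.not_dvd (X_prime.dvd_of_dvd_pow h1)

lemma dvd_of_dvd_X_zero_mul (h : IsSeparableBinaryForm s V) {w : MvPolynomial (Fin 3) k}
    (hw : V ∣ X 0 * w) : V ∣ w :=
  ((X_prime.irreducible.isRelPrime_iff_not_dvd.2 h.not_X_zero_dvd).symm).dvd_of_dvd_mul_left hw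

lemma isRelPrime_X_two_pow (h : IsSeparableBinaryForm s V) (N : ℕ) : IsRelPrime V (X 2 ^ N) :=
  (X_prime.irreducible.isRelPrime_iff_not_dvd.2 h.not_dvd).symm.pow_right

lemma dvd_of_dvd_mul_pderiv (h : IsSeparableBinaryForm s V) {w : MvPolynomial (Fin 3) k}
    (hw : V ∣ w * pderiv 1 V) : V ∣ w := by
  obtain ⟨A, B, hAB⟩ := h.bezout
  refine (h.isRelPrime_X_two_pow s).dvd_of_dvd_mul_left ?_
  have : X 2 ^ s * w = V * (A * w) + (w * pderiv 1 V) * B := by rw [hAB]; ring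
  rw [this]
  exact dvd_add (dvd_mul_right _ _) (hw.mul_right _)

lemma mem_span_iff (h : IsSeparableBinaryForm s V) {p : MvPolynomial (Fin 3) k} :
    p ∈ Ideal.span {X 0, V} ↔ V ∣ killX p := by
  rw [Ideal.mem_span_pair]
  constructor
  · rintro ⟨a, b, rfl⟩
    simp [h.killX_eq]
  · rintro ⟨b, hb⟩
    obtain ⟨a, ha⟩ := X_zero_dvd_sub_killX p
    exact ⟨a, b, by linear_combination -ha - hb⟩

end IsSeparableBinaryForm

/-! ### The curve attached to a separable binary form -/

/-- The curve `x z^c V^(m+1) + z^(c+(m+1)s+1)`. -/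
noncomputable def binaryCurve (c m s : ℕ) (V : MvPolynomial (Fin 3) k) : MvPolynomial (Fin 3) k :=
  X 0 * X 2 ^ c * V ^ (m + 1) + X 2 ^ (c + (m + 1) * s + 1)

/-- The conditions on the parameters under which the Bourbaki ideal of `binaryCurve c m s V` is
`(x, V)`. -/
structure IsAdmissible (c m s : ℕ) (V : MvPolynomial (Fin 3) k) : Prop
    extends IsSeparableBinaryForm s V where
  le_one : c ≤ 1
  two_le : 2 ≤ m
  cast_ne_zero : ((m + 1 : ℕ) : k) ≠ 0
  degree_ne_zero : ((c + (m + 1) * s + 1 : ℕ) : k) ≠ 0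

variable {c m s : ℕ} {V : MvPolynomial (Fin 3) k}

/-- The factor `z^c V^m`, shared by `F_x` and `F_y`. -/
noncomputable def commonFactor (c m : ℕ) (V : MvPolynomial (Fin 3) k) : MvPolynomial (Fin 3) k :=
  X 2 ^ c * V ^ m

lemma pderiv_two_binaryCurve (hm : 1 ≤ m) : ∃ K, pderiv 2 (binaryCurve c m s V) =
    V * K + C ((c + (m + 1) * s + 1 : ℕ) : k) * X 2 ^ (c + (m + 1) * s) := by
  obtain ⟨l, rfl⟩ := Nat.exists_eq_add_of_le' hm
  refine ⟨X 0 * (V ^ (l + 1) * pderiv 2 (X 2 ^ c)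
    + X 2 ^ c * (C ((l + 1 + 1 : ℕ) : k) * V ^ l * pderiv 2 V)), ?_⟩
  have h02 : pderiv 2 (X 0 : MvPolynomial (Fin 3) k) = 0 := pderiv_X_of_ne (by decide)
  have hn : ∀ n : ℕ, (C (n : k) : MvPolynomial (Fin 3) k) = n := fun n => by simp
  simp only [binaryCurve, map_add, Derivation.leibniz, Derivation.leibniz_pow, h02, hn,
    pderiv_X_self, smul_eq_mul, nsmul_eq_mul, Nat.add_sub_cancel]
  ring

namespace IsAdmissible

lemma pderiv_zero_binaryCurve (h : IsAdmissible c m s V) :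
    pderiv 0 (binaryCurve c m s V) = commonFactor c m V * V := by
  have h20 : pderiv 0 (X 2 : MvPolynomial (Fin 3) k) = 0 := pderiv_X_of_ne (by decide)
  simp [binaryCurve, commonFactor, Derivation.leibniz, Derivation.leibniz_pow, h20, h.pderiv_zero]
  ring

lemma pderiv_one_binaryCurve : pderiv 1 (binaryCurve c m s V) =
    commonFactor c m V * (C ((m + 1 : ℕ) : k) * X 0 * pderiv 1 V) := by
  have h21 : pderiv 1 (X 2 : MvPolynomial (Fin 3) k) = 0 := pderiv_X_of_ne (by decide)
  have h01 : pderiv 1 (X 0 : MvPolynomial (Fin 3) k) = 0 := pderiv_X_of_ne (by decide)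
  simp [binaryCurve, commonFactor, Derivation.leibniz, Derivation.leibniz_pow, h21, h01]
  ring

lemma commonFactor_ne_zero (h : IsAdmissible c m s V) : commonFactor c m V ≠ 0 :=
  mul_ne_zero (pow_ne_zero _ (X_ne_zero _)) (pow_ne_zero _ h.ne_zero)

lemma isHomogeneous_commonFactor (h : IsAdmissible c m s V) :
    (commonFactor c m V).IsHomogeneous (c + m * s) := by
  have := (isHomogeneous_X_pow (R := k) (2 : Fin 3) c).mul (h.isHomogeneous.pow m)
  rwa [mul_comm s m] at this

lemma isHomogeneous_binaryCurve (h : IsAdmissible c m s V) :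
    (binaryCurve c m s V).IsHomogeneous (c + (m + 1) * s + 1) := by
  refine IsHomogeneous.add ?_ (isHomogeneous_X_pow _ _)
  have := ((isHomogeneous_X k (0 : Fin 3)).mul (isHomogeneous_X_pow (R := k) 2 c)).mul
    (h.isHomogeneous.pow (m + 1))
  convert this using 1
  ring

lemma isHomogeneous_pderiv_two (h : IsAdmissible c m s V) :
    (pderiv 2 (binaryCurve c m s V)).IsHomogeneous (c + (m + 1) * s) := by
  simpa using h.isHomogeneous_binaryCurve.pderiv (i := 2)

lemma squarefree_binaryCurve (h : IsAdmissible c m s V) : Squarefree (binaryCurve c m s V) := by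
  have h0 : binaryCurve c m s V ≠ 0 := by
    intro h0
    have h1 := h.pderiv_zero_binaryCurve
    rw [h0, map_zero] at h1
    exact mul_ne_zero h.commonFactor_ne_zero h.ne_zero h1.symm
  rw [squarefree_iff_irreducible_sq_not_dvd_of_ne_zero h0]
  intro P hP hPP
  have hP' : Prime P := hP.prime
  -- A repeated factor divides `F_x = z^c V^(m+1)`, so it divides `z`, or it divides `V` and then
  -- also `F - x z^c V^(m+1)`, a power of `z`.
  have hz : P ∣ X 2 := by
    have hx := dvd_pderiv_of_mul_self_dvd hPP 0
    rw [h.pderiv_zero_binaryCurve, commonFactor] at hx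
    rcases hP'.dvd_or_dvd hx with hx | hx
    · rcases hP'.dvd_or_dvd hx with hx | hx
      · exact hP'.dvd_of_dvd_pow hx
      · have hPF : P ∣ binaryCurve c m s V := (dvd_mul_right P P).trans hPP
        rw [binaryCurve, dvd_add_right ((hP'.dvd_of_dvd_pow hx |>.trans
          (dvd_pow_self _ m.succ_ne_zero)).mul_left _)] at hPF
        exact hP'.dvd_of_dvd_pow hPF
    · have hPF : P ∣ binaryCurve c m s V := (dvd_mul_right P P).trans hPP
      rw [binaryCurve, dvd_add_right ((hx.trans (dvd_pow_self _ m.succ_ne_zero)).mul_left _)] at hPF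
      exact hP'.dvd_of_dvd_pow hPF
  have hzP : X 2 ∣ P := (hP'.associated_of_dvd X_prime hz).symm.dvd
  -- So `z` would be a repeated factor, that is, `z^(2-c)` would divide `x V^(m+1) + z^((m+1)s+1)`.
  have hzF : X 2 * X 2 ∣ binaryCurve c m s V := (mul_dvd_mul hzP hzP).trans hPP
  have hzc : X 2 ^ (c + 1) ∣ binaryCurve c m s V := by
    refine dvd_trans ?_ hzF
    rw [← sq]
    exact pow_dvd_pow _ (by have := h.le_one; omega)
  have e : binaryCurve c m s V =
      X 2 ^ c * (X 0 * V ^ (m + 1) + X 2 * X 2 ^ ((m + 1) * s)) := by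
    rw [binaryCurve]; ring
  rw [e, pow_succ, mul_dvd_mul_iff_left (pow_ne_zero _ (X_ne_zero _)),
    dvd_add_left (dvd_mul_right _ _)] at hzc
  exact h.not_X_two_dvd_mul_pow _ hzc

lemma isRelPrime_commonFactor (h : IsAdmissible c m s V) :
    IsRelPrime (commonFactor c m V) (pderiv 2 (binaryCurve c m s V)) := by
  refine IsRelPrime.mul_left ?_ (IsRelPrime.pow_left ?_)
  · rcases Nat.le_one_iff_eq_zero_or_eq_one.1 h.le_one with rfl | rfl
    · simpa using isRelPrime_one_left
    · refine IsRelPrime.pow_left (X_prime.irreducible.isRelPrime_iff_not_dvd.2 ?_)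
      have e : pderiv 2 (binaryCurve 1 m s V) = X 0 * V ^ (m + 1) +
          X 2 * (X 0 * pderiv 2 (V ^ (m + 1)) + C ((1 + (m + 1) * s + 1 : ℕ) : k) *
            X 2 ^ ((m + 1) * s)) := by
        have h02 : pderiv 2 (X 0 : MvPolynomial (Fin 3) k) = 0 := pderiv_X_of_ne (by decide)
        have hn : ∀ n : ℕ, (C (n : k) : MvPolynomial (Fin 3) k) = n := fun n => by simp
        simp only [binaryCurve, map_add, Derivation.leibniz, Derivation.leibniz_pow, h02, hn,
          pderiv_X_self, smul_eq_mul, nsmul_eq_mul, Nat.add_sub_cancel]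
        ring
      rw [e, dvd_add_left (dvd_mul_right _ _)]
      exact h.not_X_two_dvd_mul_pow _
  · obtain ⟨K, hK⟩ := pderiv_two_binaryCurve (c := c) (s := s) (V := V)
      (show 1 ≤ m by have := h.two_le; omega)
    intro d hd hd'
    rw [hK, dvd_add_right (hd.mul_right _),
      (isUnit_iff_ne_zero.2 h.degree_ne_zero).map C |>.dvd_mul_left] at hd'
    exact h.isRelPrime_X_two_pow _ hd hd'

end IsAdmissible

/-! ### The syzygies of the curve -/

lemma mem_jacobianSyzygies_iff {F : MvPolynomial (Fin 3) k} {u : Fin 3 → MvPolynomial (Fin 3) k} :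
    u ∈ jacobianSyzygies F ↔
      u 0 * pderiv 0 F + u 1 * pderiv 1 F + u 2 * pderiv 2 F = 0 := by
  rw [← Fin.sum_univ_three (fun i => u i * pderiv i F)]
  rfl

namespace IsAdmissible

lemma mem_jacobianSyzygies_binaryCurve_iff (h : IsAdmissible c m s V)
    {u : Fin 3 → MvPolynomial (Fin 3) k} : u ∈ jacobianSyzygies (binaryCurve c m s V) ↔
      commonFactor c m V * (u 0 * V + u 1 * (C ((m + 1 : ℕ) : k) * X 0 * pderiv 1 V)) +
        u 2 * pderiv 2 (binaryCurve c m s V) = 0 := by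
  rw [mem_jacobianSyzygies_iff, h.pderiv_zero_binaryCurve, pderiv_one_binaryCurve]
  ring_nf

/-- The third entry of a syzygy is a multiple of `z^c V^m`, this form being coprime to `F_z`. -/
lemma exists_eq_mul_commonFactor (h : IsAdmissible c m s V)
    (u : jacobianSyzygies (binaryCurve c m s V)) : ∃ q, u.1 2 = q * commonFactor c m V := by
  have hu := h.mem_jacobianSyzygies_binaryCurve_iff.1 u.2
  obtain ⟨q, hq⟩ := h.isRelPrime_commonFactor.dvd_of_dvd_mul_right (y := u.1 2)
    ((dvd_add_right (dvd_mul_right _ _)).1 (hu ▸ dvd_zero _))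
  exact ⟨q, by rw [hq, mul_comm]⟩

/-- The map sending a syzygy `u` to the quotient of its third entry by `z^c V^m`. This is the `q`
with `u × ε = q ∇F`, for `ε` the syzygy `minimalSyzygy`. -/
noncomputable def bourbakiMap (h : IsAdmissible c m s V) :
    jacobianSyzygies (binaryCurve c m s V) →ₗ[MvPolynomial (Fin 3) k] MvPolynomial (Fin 3) k where
  toFun u := (h.exists_eq_mul_commonFactor u).choose
  map_add' u v := by
    apply mul_right_cancel₀ h.commonFactor_ne_zero
    rw [add_mul, ← (h.exists_eq_mul_commonFactor (u + v)).choose_spec,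
      ← (h.exists_eq_mul_commonFactor u).choose_spec,
      ← (h.exists_eq_mul_commonFactor v).choose_spec]
    rfl
  map_smul' r u := by
    apply mul_right_cancel₀ h.commonFactor_ne_zero
    rw [RingHom.id_apply, smul_eq_mul, mul_assoc,
      ← (h.exists_eq_mul_commonFactor (r • u)).choose_spec,
      ← (h.exists_eq_mul_commonFactor u).choose_spec]
    rfl

lemma bourbakiMap_mul (h : IsAdmissible c m s V) (u : jacobianSyzygies (binaryCurve c m s V)) :
    h.bourbakiMap u * commonFactor c m V = u.1 2 :=
  (h.exists_eq_mul_commonFactor u).choose_spec.symm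

lemma bourbakiMap_eq (h : IsAdmissible c m s V) {u : jacobianSyzygies (binaryCurve c m s V)}
    {q : MvPolynomial (Fin 3) k} (hq : u.1 2 = q * commonFactor c m V) : h.bourbakiMap u = q :=
  mul_right_cancel₀ h.commonFactor_ne_zero ((h.bourbakiMap_mul u).trans hq)

lemma bourbakiMap_relation (h : IsAdmissible c m s V)
    (u : jacobianSyzygies (binaryCurve c m s V)) :
    u.1 0 * V + u.1 1 * (C ((m + 1 : ℕ) : k) * X 0 * pderiv 1 V) +
      h.bourbakiMap u * pderiv 2 (binaryCurve c m s V) = 0 := by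
  have hu := h.mem_jacobianSyzygies_binaryCurve_iff.1 u.2
  rw [← h.bourbakiMap_mul] at hu
  apply mul_left_cancel₀ h.commonFactor_ne_zero
  linear_combination hu

lemma exists_bourbakiMap_eq (h : IsAdmissible c m s V) {a b q : MvPolynomial (Fin 3) k}
    (hq : a * V + b * (C ((m + 1 : ℕ) : k) * X 0 * pderiv 1 V) +
      q * pderiv 2 (binaryCurve c m s V) = 0) :
    ∃ u : jacobianSyzygies (binaryCurve c m s V),
      u.1 = ![a, b, q * commonFactor c m V] ∧ h.bourbakiMap u = q := by
  refine ⟨⟨![a, b, q * commonFactor c m V], ?_⟩, rfl, h.bourbakiMap_eq rfl⟩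
  rw [h.mem_jacobianSyzygies_binaryCurve_iff]
  simp only [Matrix.cons_val]
  linear_combination commonFactor c m V * hq

/-- The syzygy `((m+1) x V_y, -V, 0)`. -/
noncomputable def minimalSyzygy (h : IsAdmissible c m s V) :
    jacobianSyzygies (binaryCurve c m s V) :=
  ⟨![C ((m + 1 : ℕ) : k) * X 0 * pderiv 1 V, -V, 0], by
    rw [h.mem_jacobianSyzygies_binaryCurve_iff]
    simp only [Matrix.cons_val]
    ring⟩

lemma isUnit_C_cast (h : IsAdmissible c m s V) :
    IsUnit (C ((m + 1 : ℕ) : k) : MvPolynomial (Fin 3) k) :=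
  (isUnit_iff_ne_zero.2 h.cast_ne_zero).map C

lemma ker_bourbakiMap (h : IsAdmissible c m s V) :
    LinearMap.ker h.bourbakiMap = Submodule.span (MvPolynomial (Fin 3) k) {h.minimalSyzygy} := by
  ext u
  rw [LinearMap.mem_ker, Submodule.mem_span_singleton]
  constructor
  · intro hu
    have hrel := h.bourbakiMap_relation u
    have h2 := h.bourbakiMap_mul u
    rw [hu, zero_mul] at hrel h2
    rw [add_zero] at hrel
    have hdvd : V ∣ u.1 1 := by
      apply h.dvd_of_dvd_mul_pderiv
      apply h.dvd_of_dvd_X_zero_mul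
      rw [← h.isUnit_C_cast.dvd_mul_left]
      refine ⟨-u.1 0, ?_⟩
      linear_combination hrel
    obtain ⟨t, ht⟩ := hdvd
    refine ⟨-t, Subtype.ext (funext fun i => ?_)⟩
    have h0 : u.1 0 = -t * (C ((m + 1 : ℕ) : k) * X 0 * pderiv 1 V) := by
      apply mul_right_cancel₀ h.ne_zero
      rw [ht] at hrel
      linear_combination hrel
    fin_cases i
    · exact h0.symm
    · exact (show -t * -V = u.1 1 by rw [ht]; ring)
    · exact (show -t * 0 = u.1 2 by rw [← h2, mul_zero])
  · rintro ⟨t, rfl⟩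
    rw [map_smul, h.bourbakiMap_eq (u := h.minimalSyzygy) (q := 0) (by rw [zero_mul]; rfl),
      smul_zero]

/-- Modulo `V` and `x V_y` the form `F_z` is a constant times a high power of `z`. As `(x, V)` is
the part of `(x V_y, V)` supported off `z = 0`, the values of the map, which are the multipliers
of `F_z` into `(x V_y, V)`, make up `(x, V)`. -/
lemma range_bourbakiMap (h : IsAdmissible c m s V) :
    LinearMap.range h.bourbakiMap = Ideal.span {X 0, V} := by
  obtain ⟨K, hK⟩ := pderiv_two_binaryCurve (c := c) (s := s) (V := V)
    (show 1 ≤ m by have := h.two_le; omega)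
  have hw := (isUnit_iff_ne_zero.2 h.degree_ne_zero).map
    (C : k →+* MvPolynomial (Fin 3) k)
  apply le_antisymm
  · rintro _ ⟨u, rfl⟩
    rw [h.mem_span_iff]
    have hrel := congrArg killX (h.bourbakiMap_relation u)
    rw [hK] at hrel
    simp only [map_add, map_mul, h.killX_eq, killX_X_zero, map_pow, killX_X_two, map_zero,
      mul_zero, zero_mul, add_zero] at hrel
    apply (h.isRelPrime_X_two_pow (c + (m + 1) * s)).dvd_of_dvd_mul_left
    rw [← hw.dvd_mul_left]
    refine ⟨-(killX (u.1 0) + killX (h.bourbakiMap u) * killX K), ?_⟩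
    have hC : ∀ r : k, killX (C r : MvPolynomial (Fin 3) k) = C r := fun r => by simp [killX]
    rw [hC] at hrel
    linear_combination hrel
  · rw [Ideal.span_le, Set.insert_subset_iff, Set.singleton_subset_iff]
    constructor
    · obtain ⟨A, B, hAB⟩ := h.bezout
      have hN : c + (m + 1) * s = (c + m * s) + s := by ring
      obtain ⟨r, hr⟩ := h.isUnit_C_cast.exists_left_inv
      set w := (C ((c + (m + 1) * s + 1 : ℕ) : k) : MvPolynomial (Fin 3) k)
      obtain ⟨u, -, hu⟩ := h.exists_bourbakiMap_eq (q := X 0)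
        (a := -(X 0 * K + w * X 0 * X 2 ^ (c + m * s) * A))
        (b := -(r * w * X 2 ^ (c + m * s) * B)) (by
          rw [hK, hN, pow_add _ (c + m * s) s, hAB]
          linear_combination -(w * X 2 ^ (c + m * s) * B * X 0 * pderiv 1 V) * hr)
      exact ⟨u, hu⟩
    · obtain ⟨u, -, hu⟩ := h.exists_bourbakiMap_eq (q := V)
        (a := -pderiv 2 (binaryCurve c m s V)) (b := 0) (by ring)
      exact ⟨u, hu⟩

/-! ### Minimality and uniqueness of the syzygy of degree `s` -/

lemma isHomogeneous_minimalSyzygy (h : IsAdmissible c m s V) :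
    IsHomogeneousSyzygy h.minimalSyzygy s := by
  intro i
  fin_cases i
  · have h1 := (((isHomogeneous_X k (0 : Fin 3)).C_mul ((m + 1 : ℕ) : k))).mul
      (h.isHomogeneous.pderiv (i := 1))
    rwa [Nat.add_sub_cancel' h.pos] at h1
  · exact h.isHomogeneous.neg
  · exact isHomogeneous_zero _ _ _

lemma minimalSyzygy_ne_zero (h : IsAdmissible c m s V) : h.minimalSyzygy ≠ 0 := by
  intro h0
  have : -V = 0 := congrArg (fun u => u.1 1) h0
  exact h.ne_zero (neg_eq_zero.1 this)

/-- In degrees up to `s` every syzygy is a multiple of the minimal one: the third entry would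
otherwise be a nonzero multiple of `z^c V^m`, of degree at least `2 s`. -/
lemma exists_eq_smul_minimalSyzygy (h : IsAdmissible c m s V)
    {u : jacobianSyzygies (binaryCurve c m s V)} {j : ℕ} (hu : IsHomogeneousSyzygy u j)
    (hj : j ≤ s) : ∃ t : MvPolynomial (Fin 3) k,
      u = t • h.minimalSyzygy ∧ IsHomogeneousOfDegree t ((j : ℤ) - s) := by
  have h2 := hu 2
  rw [← h.bourbakiMap_mul] at h2
  have h0 : h.bourbakiMap u = 0 :=
    (isHomogeneousOfDegree_of_mul h.commonFactor_ne_zero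
      h.isHomogeneous_commonFactor h2).eq_zero <| by
      have h3 : 2 * s ≤ m * s := Nat.mul_le_mul_right _ h.two_le
      have := h.pos
      omega
  rw [← LinearMap.mem_ker, h.ker_bourbakiMap, Submodule.mem_span_singleton] at h0
  obtain ⟨t, rfl⟩ := h0
  exact ⟨t, rfl, isHomogeneousOfDegree_of_mul (neg_ne_zero.2 h.ne_zero) h.isHomogeneous.neg (hu 1)⟩

lemma isMinimalSyzygy (h : IsAdmissible c m s V) : IsMinimalSyzygy h.minimalSyzygy s where
  ne_zero := h.minimalSyzygy_ne_zero
  isHomogeneous := h.isHomogeneous_minimalSyzygy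
  minimal u j hu0 hu := by
    by_contra! hj
    obtain ⟨t, rfl, ht⟩ := h.exists_eq_smul_minimalSyzygy hu hj.le
    exact hu0 (by rw [ht.eq_zero (by omega), zero_smul])

lemma eq_and_span_eq_of_isMinimalSyzygy (h : IsAdmissible c m s V)
    {u : jacobianSyzygies (binaryCurve c m s V)} {e : ℕ} (hu : IsMinimalSyzygy u e) :
    e = s ∧ Submodule.span (MvPolynomial (Fin 3) k) {u} = LinearMap.ker h.bourbakiMap := by
  have he : e = s := le_antisymm
    (hu.minimal _ _ h.minimalSyzygy_ne_zero h.isHomogeneous_minimalSyzygy)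
    (h.isMinimalSyzygy.minimal _ _ hu.ne_zero hu.isHomogeneous)
  obtain ⟨t, rfl, ht⟩ := h.exists_eq_smul_minimalSyzygy hu.isHomogeneous he.le
  rw [he, sub_self] at ht
  obtain ⟨r, rfl⟩ := ht.eq_C
  have hr : r ≠ 0 := fun hr => hu.ne_zero (by rw [hr, C_0, zero_smul])
  rw [h.ker_bourbakiMap,
    Submodule.span_singleton_smul_eq ((isUnit_iff_ne_zero.2 hr).map C)]
  exact ⟨he, rfl⟩

/-! ### The Bourbaki ideal -/

lemma isBourbakiIdeal (h : IsAdmissible c m s V) :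
    IsBourbakiIdeal (c + (m + 1) * s) (binaryCurve c m s V) (Ideal.span {X 0, V}) := by
  refine ⟨s, h.minimalSyzygy, h.isMinimalSyzygy,
    (Submodule.quotEquivOfEq _ _ h.ker_bourbakiMap.symm).trans
      (h.bourbakiMap.quotKerEquivRange.trans (LinearEquiv.ofEq _ _ h.range_bourbakiMap)), ?_⟩
  intro u j hu
  have h2 := hu 2
  rw [← h.bourbakiMap_mul] at h2
  have h3 := isHomogeneousOfDegree_of_mul h.commonFactor_ne_zero h.isHomogeneous_commonFactor h2
  have e : (j : ℤ) + s - (c + (m + 1) * s : ℕ) = j - (c + m * s : ℕ) := by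
    push_cast; ring
  rw [e]
  exact h3

/-- Two isomorphisms of the same quotient with ideals differ by a fraction. Here the fraction is a
form of degree `0`, because `x` and `V` are coprime and the degree shift is prescribed. -/
lemma eq_of_isBourbakiIdeal (h : IsAdmissible c m s V) {I : Ideal (MvPolynomial (Fin 3) k)}
    (hI : IsBourbakiIdeal (c + (m + 1) * s) (binaryCurve c m s V) I) :
    I = Ideal.span {X 0, V} := by
  obtain ⟨e, ε, hε, φ, hφ⟩ := hI
  obtain ⟨rfl, hspan⟩ := h.eq_and_span_eq_of_isMinimalSyzygy hε
  let ψ : jacobianSyzygies (binaryCurve c m e V) →ₗ[MvPolynomial (Fin 3) k]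
      MvPolynomial (Fin 3) k := I.subtype ∘ₗ φ.toLinearMap ∘ₗ Submodule.mkQ _
  have hker : ∀ u, ψ u = 0 ↔ h.bourbakiMap u = 0 := by
    intro u
    rw [← LinearMap.mem_ker (f := h.bourbakiMap), ← hspan,
      ← Submodule.Quotient.mk_eq_zero (Submodule.span _ {ε})]
    simp [ψ]
  have hrange : LinearMap.range ψ = I := by
    rw [LinearMap.range_comp, LinearMap.range_comp, Submodule.range_mkQ, Submodule.map_top,
      LinearEquiv.range, Submodule.map_top, Submodule.range_subtype]
  have hprop : ∀ u v, h.bourbakiMap u * ψ v = h.bourbakiMap v * ψ u := by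
    intro u v
    have := (hker (h.bourbakiMap u • v - h.bourbakiMap v • u)).2 (by
      simp only [map_sub, map_smul, smul_eq_mul]; ring)
    simpa [sub_eq_zero] using this
  obtain ⟨v, hv, hvV⟩ := h.exists_bourbakiMap_eq (q := V)
    (a := -pderiv 2 (binaryCurve c m e V)) (b := 0) (by ring)
  obtain ⟨x, hx⟩ : X 0 ∈ LinearMap.range h.bourbakiMap :=
    h.range_bourbakiMap ▸ Ideal.subset_span (by simp)
  obtain ⟨g, hg⟩ : V ∣ ψ v := by
    apply h.dvd_of_dvd_X_zero_mul
    rw [← hx, hprop, hvV]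
    exact dvd_mul_right _ _
  have hψ : ∀ u, ψ u = g * h.bourbakiMap u := by
    intro u
    apply mul_left_cancel₀ h.ne_zero
    have := hprop v u
    rw [hvV, hg] at this
    linear_combination this
  have hvhom : IsHomogeneousSyzygy v (c + (m + 1) * e) := by
    intro i
    rw [hv]
    fin_cases i
    · exact h.isHomogeneous_pderiv_two.neg
    · exact isHomogeneous_zero _ _ _
    · have := h.isHomogeneous.mul h.isHomogeneous_commonFactor
      rwa [show e + (c + m * e) = c + (m + 1) * e by ring] at this
  have hgdeg : IsHomogeneousOfDegree g 0 := by
    have h1 : IsHomogeneousOfDegree (ψ v) ((e : ℕ) : ℤ) := by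
      have := hφ v _ hvhom
      rwa [add_sub_cancel_left] at this
    rw [hg, mul_comm] at h1
    simpa using isHomogeneousOfDegree_of_mul h.ne_zero h.isHomogeneous h1.isHomogeneous
  obtain ⟨r, rfl⟩ := hgdeg.eq_C
  have hr : r ≠ 0 := by
    rintro rfl
    have := (hker v).1 (by rw [hψ, C_0, zero_mul])
    exact h.ne_zero (hvV ▸ this)
  have hunit : IsUnit (C r : MvPolynomial (Fin 3) k) := (isUnit_iff_ne_zero.2 hr).map C
  rw [← hrange, ← h.range_bourbakiMap]
  ext p
  constructor
  · rintro ⟨u, rfl⟩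
    exact ⟨C r • u, by rw [map_smul, hψ, smul_eq_mul]⟩
  · rintro ⟨u, rfl⟩
    obtain ⟨r', hr'⟩ := hunit.exists_left_inv
    exact ⟨r' • u, by rw [map_smul, hψ, smul_eq_mul, ← mul_assoc, hr', one_mul]⟩

end IsAdmissible

/-! ### The degree of the Bourbaki ideal -/

/-- The form `y^(r+1) + z^r (a y + b z)`. -/
noncomputable def binaryForm (a b : k) (r : ℕ) : MvPolynomial (Fin 3) k :=
  X 1 ^ (r + 1) + X 2 ^ r * (C a * X 1 + C b * X 2)

/-- The forms `y^i z^(m-i)` with `i ≤ r` are linearly independent modulo `(x, V)`: setting `x = 0`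
and `z = 1` turns `V` into a monic polynomial of degree `r + 1`. -/
lemma linearIndependent_mk_monomials {a b : k} {r : ℕ} (ha : r = 0 → a = 0) (m : ℕ) :
    LinearIndependent k (fun i : Fin (r + 1) =>
      Ideal.Quotient.mkₐ k (Ideal.span {X 0, binaryForm a b r})
        (X 1 ^ (i : ℕ) * X 2 ^ (m - i) : MvPolynomial (Fin 3) k)) := by
  rw [Fintype.linearIndependent_iff]
  intro w hw
  simp only [← map_smul, ← map_sum] at hw
  rw [Ideal.Quotient.mkₐ_eq_mk, Ideal.Quotient.eq_zero_iff_mem, Ideal.mem_span_pair] at hw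
  obtain ⟨A, B, hAB⟩ := hw
  let τ : MvPolynomial (Fin 3) k →ₐ[k] Polynomial k := aeval ![0, Polynomial.X, 1]
  have hτ0 : τ (X 0) = 0 := by simp [τ]
  have hτ1 : τ (X 1) = Polynomial.X := by simp [τ]
  have hτ2 : τ (X 2) = 1 := by simp [τ]
  have hτC : ∀ t, τ (C t) = Polynomial.C t := fun t => by simp [τ]
  have hdeg : (Polynomial.C a * Polynomial.X + Polynomial.C b).degree <
      ((r + 1 : ℕ) : WithBot ℕ) := by
    rcases Nat.eq_zero_or_pos r with rfl | hr
    · rw [ha rfl, map_zero, zero_mul, zero_add]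
      exact Polynomial.degree_C_le.trans_lt (by norm_num)
    · exact Polynomial.degree_linear_le.trans_lt (by exact_mod_cast (by omega : 1 < r + 1))
  have hV : τ (binaryForm a b r) =
      Polynomial.X ^ (r + 1) + (Polynomial.C a * Polynomial.X + Polynomial.C b) := by
    simp [binaryForm, hτ1, hτ2, hτC]
  have hmonic : (τ (binaryForm a b r)).Monic := by
    rw [hV]
    exact Polynomial.monic_X_pow_add hdeg
  have hVdeg : (τ (binaryForm a b r)).degree = ((r + 1 : ℕ) : WithBot ℕ) := by
    rw [hV, Polynomial.degree_add_eq_left_of_degree_lt (by rwa [Polynomial.degree_X_pow]),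
      Polynomial.degree_X_pow]
  have h1 := congrArg τ hAB
  simp only [map_add, map_mul, hτ0, mul_zero, zero_add, map_sum, map_smul, map_pow, hτ1, hτ2,
    one_pow, mul_one] at h1
  have h2 : ∑ i : Fin (r + 1), w i • (Polynomial.X : Polynomial k) ^ (i : ℕ) = 0 := by
    by_contra hne
    refine hmonic.not_dvd_of_degree_lt hne ?_ ⟨τ B, by rw [← h1, mul_comm]⟩
    rw [hVdeg]
    refine (Polynomial.degree_sum_le _ _).trans_lt ?_
    rw [Finset.sup_lt_iff (WithBot.bot_lt_coe _)]
    intro i _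
    refine (Polynomial.degree_smul_le _ _).trans_lt ?_
    rw [Polynomial.degree_X_pow]
    exact_mod_cast i.2
  intro i
  have h3 := congrArg (fun p => Polynomial.coeff p (i : ℕ)) h2
  simpa [Polynomial.finsetSum_coeff, Polynomial.coeff_X_pow, Fin.val_inj] using h3

lemma mk_monomial_mem_span {a b : k} {r : ℕ} (ha : r = 0 → a = 0) {m : ℕ} (i j : ℕ)
    (hij : i + j = m) :
    Ideal.Quotient.mkₐ k (Ideal.span {X 0, binaryForm a b r})
        (X 1 ^ i * X 2 ^ j : MvPolynomial (Fin 3) k) ∈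
      Submodule.span k (Set.range fun i : Fin (r + 1) =>
        Ideal.Quotient.mkₐ k (Ideal.span {X 0, binaryForm a b r})
          (X 1 ^ (i : ℕ) * X 2 ^ (m - i) : MvPolynomial (Fin 3) k)) := by
  induction i using Nat.strong_induction_on generalizing j with
  | _ i ih =>
  rcases Nat.lt_or_ge i (r + 1) with hi | hi
  · refine Submodule.subset_span ⟨⟨i, hi⟩, ?_⟩
    rw [show j = m - i by omega]
  · obtain ⟨t, rfl⟩ := Nat.exists_eq_add_of_le hi
    have e : (X 1 ^ (r + 1 + t) * X 2 ^ j : MvPolynomial (Fin 3) k) =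
        binaryForm a b r * (X 1 ^ t * X 2 ^ j) - a • (X 1 ^ (t + 1) * X 2 ^ (j + r))
          - b • (X 1 ^ t * X 2 ^ (j + r + 1)) := by
      rw [smul_eq_C_mul, smul_eq_C_mul, binaryForm]
      ring
    have h0 : Ideal.Quotient.mkₐ k (Ideal.span {X 0, binaryForm a b r})
        (binaryForm a b r * (X 1 ^ t * X 2 ^ j)) = 0 := by
      rw [Ideal.Quotient.mkₐ_eq_mk, Ideal.Quotient.eq_zero_iff_mem]
      exact Ideal.mul_mem_right _ _ (Ideal.subset_span (by simp))
    rw [e, map_sub, map_sub, h0, zero_sub, map_smul, map_smul]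
    refine Submodule.sub_mem _ (Submodule.neg_mem _ ?_)
      (Submodule.smul_mem _ _ (ih t (by omega) _ (by omega)))
    -- For `r = 0` the exponent `t + 1` is not smaller than `r + 1 + t`, but then `a = 0`.
    rcases Nat.eq_zero_or_pos r with hr | hr
    · rw [ha hr, zero_smul]
      exact Submodule.zero_mem _
    · exact Submodule.smul_mem _ _ (ih (t + 1) (by omega) _ (by omega))

lemma hilbertFunction_span_binaryForm {a b : k} {r : ℕ} (ha : r = 0 → a = 0) {m : ℕ}
    (hm : r ≤ m) : hilbertFunction (Ideal.span {X 0, binaryForm a b r}) m = r + 1 := by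
  have key : (homogeneousSubmodule (Fin 3) k m).map
      (Ideal.Quotient.mkₐ k (Ideal.span {X 0, binaryForm a b r})).toLinearMap =
      Submodule.span k (Set.range fun i : Fin (r + 1) =>
        Ideal.Quotient.mkₐ k (Ideal.span {X 0, binaryForm a b r})
          (X 1 ^ (i : ℕ) * X 2 ^ (m - i) : MvPolynomial (Fin 3) k)) := by
    apply le_antisymm
    · rintro _ ⟨p, hp, rfl⟩
      rw [p.as_sum, map_sum]
      refine Submodule.sum_mem _ fun μ hμ => ?_
      have hμdeg : μ.degree = m := by
        by_contra hne
        exact mem_support_iff.1 hμ (((mem_homogeneousSubmodule m p).1 hp).coeff_eq_zero hne)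
      have hsum : μ 0 + μ 1 + μ 2 = m := by
        rw [← hμdeg, Finsupp.degree_eq_sum, Fin.sum_univ_three]
      rw [monomial_eq, Finsupp.prod_fintype _ _ (fun _ => pow_zero _), Fin.prod_univ_three,
        ← smul_eq_C_mul, map_smul]
      refine Submodule.smul_mem _ _ ?_
      rcases Nat.eq_zero_or_pos (μ 0) with h0 | h0
      · rw [h0, pow_zero, one_mul]
        exact mk_monomial_mem_span ha _ _ (by omega)
      · have : Ideal.Quotient.mkₐ k (Ideal.span {X 0, binaryForm a b r})
            (X 0 ^ μ 0 * X 1 ^ μ 1 * X 2 ^ μ 2) = 0 := by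
          rw [Ideal.Quotient.mkₐ_eq_mk, Ideal.Quotient.eq_zero_iff_mem]
          refine Ideal.mul_mem_right _ _ (Ideal.mul_mem_right _ _ ?_)
          exact Ideal.pow_mem_of_mem _ (Ideal.subset_span (by simp)) _ h0
        rw [AlgHom.toLinearMap_apply, this]
        exact Submodule.zero_mem _
    · rw [Submodule.span_le]
      rintro _ ⟨i, rfl⟩
      refine ⟨_, (mem_homogeneousSubmodule m _).2 ?_, rfl⟩
      have := (isHomogeneous_X_pow (R := k) (1 : Fin 3) i).mul
        (isHomogeneous_X_pow (R := k) (2 : Fin 3) (m - i))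
      rwa [Nat.add_sub_cancel' (by omega)] at this
  rw [hilbertFunction, key, finrank_span_eq_card (linearIndependent_mk_monomials ha m),
    Fintype.card_fin]

lemma hasDegree_span_binaryForm {a b : k} {r : ℕ} (ha : r = 0 → a = 0) :
    HasDegree (Ideal.span {X 0, binaryForm a b r}) (r + 1) := by
  refine ⟨Polynomial.C ((r + 1 : ℕ) : ℚ), ?_, fun _ => by
    rw [Polynomial.natDegree_C, Polynomial.leadingCoeff_C, Nat.factorial_zero, Nat.cast_one,
      one_mul],
    fun h0 => ?_⟩
  · filter_upwards [Filter.eventually_ge_atTop r] with m hm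
    rw [hilbertFunction_span_binaryForm ha hm, Polynomial.eval_C]
  · rw [Polynomial.C_eq_zero] at h0
    exact absurd h0 (by positivity)

/-! ### Choice of the parameters -/

lemma isSeparableBinaryForm_binaryForm {a b : k} {r : ℕ} (ha : r = 0 → a = 0)
    (hbez : ∃ A B, X 2 ^ (r + 1) = A * binaryForm a b r + B * pderiv 1 (binaryForm a b r)) :
    IsSeparableBinaryForm (r + 1) (binaryForm a b r) where
  pos := r.succ_pos
  isHomogeneous := by
    refine (isHomogeneous_X_pow _ _).add ((isHomogeneous_X_pow _ _).mul ?_)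
    exact (isHomogeneous_C_mul_X _ _).add (isHomogeneous_C_mul_X _ _)
  killX_eq := by
    have hC : ∀ r : k, killX (C r : MvPolynomial (Fin 3) k) = C r := fun r => by simp [killX]
    simp [binaryForm, hC]
  pderiv_zero := by
    have h1 : pderiv 0 (X 1 : MvPolynomial (Fin 3) k) = 0 := pderiv_X_of_ne (by decide)
    have h2 : pderiv 0 (X 2 : MvPolynomial (Fin 3) k) = 0 := pderiv_X_of_ne (by decide)
    simp [binaryForm, Derivation.leibniz, Derivation.leibniz_pow, h1, h2]
  not_dvd := by
    -- The form does not vanish at the point `(0 : 1 : 0)`.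
    rintro ⟨w, hw⟩
    have := congrArg (eval ![0, 1, 0]) hw
    rcases Nat.eq_zero_or_pos r with rfl | hr
    · simp [binaryForm, ha rfl] at this
    · simp [binaryForm, hr.ne'] at this
  bezout := hbez

/-- There is a separable form of each positive degree `s`: `y^s + z^s`, or `y^s + y z^(s-1)` when
the characteristic divides `s`. -/
lemma exists_isSeparableBinaryForm (k : Type*) [Field k] (r : ℕ) : ∃ a b : k, (r = 0 → a = 0) ∧
    IsSeparableBinaryForm (r + 1) (binaryForm a b r) := by
  have h21 : pderiv 1 (X 2 : MvPolynomial (Fin 3) k) = 0 := pderiv_X_of_ne (by decide)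
  have hd : ∀ a b : k, pderiv 1 (binaryForm a b r) =
      C ((r + 1 : ℕ) : k) * X 1 ^ r + C a * X 2 ^ r := by
    intro a b
    simp [binaryForm, Derivation.leibniz, Derivation.leibniz_pow, h21]
    ring
  by_cases hr : ((r + 1 : ℕ) : k) = 0
  · have h0 : r = 0 → (1 : k) = 0 := by
      rintro rfl
      simp at hr
    refine ⟨1, 0, h0, isSeparableBinaryForm_binaryForm h0 ⟨0, X 2, ?_⟩⟩
    rw [hd, hr, C_0, C_1]
    ring
  · refine ⟨0, 1, fun _ => rfl, isSeparableBinaryForm_binaryForm (fun _ => rfl)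
      ⟨1, -C ((r + 1 : ℕ) : k)⁻¹ * X 1, ?_⟩⟩
    have hinv : (C ((r + 1 : ℕ) : k)⁻¹ * C ((r + 1 : ℕ) : k) : MvPolynomial (Fin 3) k) = 1 := by
      rw [← C_mul, inv_mul_cancel₀ hr, C_1]
    rw [hd, binaryForm, C_0, C_1]
    linear_combination X 1 ^ (r + 1) * hinv

/-- Two consecutive integers do not both vanish in a field, so that `m + 1` can be taken among
`3, 4`, and the degree `c + (m + 1) s + 1` can be made nonzero with `c` among `0, 1`. -/
lemma exists_isAdmissible (h : IsSeparableBinaryForm s V) : ∃ c m, IsAdmissible c m s V := by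
  have consec : ∀ a : ℕ, (a : k) = 0 → ((a + 1 : ℕ) : k) ≠ 0 := by
    intro a ha
    rw [Nat.cast_succ, ha, zero_add]
    exact one_ne_zero
  obtain ⟨m, hm2, hm⟩ : ∃ m, 2 ≤ m ∧ ((m + 1 : ℕ) : k) ≠ 0 := by
    by_cases h3 : ((2 + 1 : ℕ) : k) = 0
    · exact ⟨3, by norm_num, consec _ h3⟩
    · exact ⟨2, le_rfl, h3⟩
  obtain ⟨c, hc1, hc⟩ : ∃ c ≤ 1, ((c + (m + 1) * s + 1 : ℕ) : k) ≠ 0 := by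
    by_cases h0 : ((0 + (m + 1) * s + 1 : ℕ) : k) = 0
    · refine ⟨1, le_rfl, ?_⟩
      rw [show 1 + (m + 1) * s + 1 = (0 + (m + 1) * s + 1) + 1 by ring]
      exact consec _ h0
    · exact ⟨0, Nat.zero_le _, h0⟩
  exact ⟨c, m, h, hc1, hm2, hm, hc⟩

/-! ### The line, whose Bourbaki ideal is the unit ideal -/

lemma mem_jacobianSyzygies_X_zero {u : Fin 3 → MvPolynomial (Fin 3) k} :
    u ∈ jacobianSyzygies (X 0 : MvPolynomial (Fin 3) k) ↔ u 0 = 0 := by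
  rw [mem_jacobianSyzygies_iff, pderiv_X_self, pderiv_X_of_ne (by decide),
    pderiv_X_of_ne (by decide)]
  simp

lemma isBourbakiIdeal_line : IsBourbakiIdeal 0 (X 0 : MvPolynomial (Fin 3) k) ⊤ := by
  let ε : jacobianSyzygies (X 0 : MvPolynomial (Fin 3) k) :=
    ⟨![0, 1, 0], mem_jacobianSyzygies_X_zero.2 rfl⟩
  let π : jacobianSyzygies (X 0 : MvPolynomial (Fin 3) k) →ₗ[MvPolynomial (Fin 3) k]
    MvPolynomial (Fin 3) k := LinearMap.proj 2 ∘ₗ Submodule.subtype _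
  have hker : Submodule.span (MvPolynomial (Fin 3) k) {ε} = LinearMap.ker π := by
    ext u
    rw [LinearMap.mem_ker, Submodule.mem_span_singleton]
    constructor
    · rintro ⟨t, rfl⟩
      exact mul_zero t
    · intro hu
      refine ⟨u.1 1, Subtype.ext (funext fun i => ?_)⟩
      fin_cases i
      · exact (mul_zero _).trans (mem_jacobianSyzygies_X_zero.1 u.2).symm
      · exact mul_one _
      · exact (mul_zero _).trans hu.symm
  have hrange : LinearMap.range π = ⊤ := by
    rw [LinearMap.range_eq_top]
    exact fun q => ⟨⟨![0, 0, q], mem_jacobianSyzygies_X_zero.2 rfl⟩, rfl⟩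
  refine ⟨0, ε, ⟨?_, ?_, fun _ _ _ _ => Nat.zero_le _⟩, (Submodule.quotEquivOfEq _ _ hker).trans
    (π.quotKerEquivRange.trans (LinearEquiv.ofEq _ _ hrange)), ?_⟩
  · intro h0
    exact one_ne_zero (α := MvPolynomial (Fin 3) k) (congrArg (fun u => u.1 1) h0)
  · intro i
    fin_cases i
    · exact isHomogeneous_zero _ _ _
    · exact isHomogeneous_one _ _
    · exact isHomogeneous_zero _ _ _
  · intro u j hu μ hμ
    have : μ.degree = j := by
      by_contra hne
      exact hμ ((hu 2).coeff_eq_zero hne)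
    simp [this]

/-- The classes of `(0, 1, 0)` and `(0, 0, 1)` generate the quotient and correspond to constants,
which do not both vanish since `ε` alone does not generate the module of syzygies. -/
lemma eq_top_of_isBourbakiIdeal_line {I : Ideal (MvPolynomial (Fin 3) k)}
    (hI : IsBourbakiIdeal 0 (X 0 : MvPolynomial (Fin 3) k) I) : I = ⊤ := by
  obtain ⟨e, ε, hε, φ, hφ⟩ := hI
  let e₁ : jacobianSyzygies (X 0 : MvPolynomial (Fin 3) k) :=
    ⟨![0, 1, 0], mem_jacobianSyzygies_X_zero.2 rfl⟩
  let e₂ : jacobianSyzygies (X 0 : MvPolynomial (Fin 3) k) :=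
    ⟨![0, 0, 1], mem_jacobianSyzygies_X_zero.2 rfl⟩
  have h₁ : IsHomogeneousSyzygy e₁ 0 := by
    intro i
    fin_cases i
    exacts [isHomogeneous_zero _ _ _, isHomogeneous_one _ _, isHomogeneous_zero _ _ _]
  have h₂ : IsHomogeneousSyzygy e₂ 0 := by
    intro i
    fin_cases i
    exacts [isHomogeneous_zero _ _ _, isHomogeneous_zero _ _ _, isHomogeneous_one _ _]
  have he : e = 0 := Nat.le_zero.1 <| hε.minimal e₁ 0
    (fun h0 => one_ne_zero (α := MvPolynomial (Fin 3) k) (congrArg (fun u => u.1 1) h0)) h₁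
  subst he
  -- A nonzero value of `φ` on a syzygy of degree `0` is a unit of `R` that lies in `I`.
  have hunit : ∀ u, IsHomogeneousSyzygy u 0 →
      (φ (Submodule.Quotient.mk u) : MvPolynomial (Fin 3) k) ≠ 0 → I = ⊤ := by
    intro u hu hne
    have h0 := hφ u 0 hu
    simp only [Nat.cast_zero, add_zero, sub_zero] at h0
    obtain ⟨r, hr⟩ := h0.eq_C
    refine Ideal.eq_top_of_isUnit_mem _ (φ (Submodule.Quotient.mk u)).2 ?_
    rw [hr] at hne ⊢
    exact (isUnit_iff_ne_zero.2 (by rintro rfl; exact hne C_0)).map C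
  have hmem : ∀ u, (φ (Submodule.Quotient.mk u) : MvPolynomial (Fin 3) k) = 0 →
      ∃ t : MvPolynomial (Fin 3) k, t • ε = u := by
    intro u hu
    rw [← Submodule.mem_span_singleton, ← Submodule.Quotient.mk_eq_zero]
    exact φ.map_eq_zero_iff.1 (Subtype.ext hu)
  by_contra htop
  obtain ⟨t₁, ht₁⟩ := hmem e₁ (by_contra fun h => htop (hunit _ h₁ h))
  obtain ⟨t₂, ht₂⟩ := hmem e₂ (by_contra fun h => htop (hunit _ h₂ h))
  have h11 : t₁ * ε.1 1 = 1 := congrArg (fun u => u.1 1) ht₁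
  have h12 : t₁ * ε.1 2 = 0 := congrArg (fun u => u.1 2) ht₁
  have h22 : t₂ * ε.1 2 = 1 := congrArg (fun u => u.1 2) ht₂
  rcases mul_eq_zero.1 h12 with h0 | h0
  · rw [h0, zero_mul] at h11
    exact zero_ne_one h11
  · rw [h0, mul_zero] at h22
    exact zero_ne_one h22

lemma hasDegree_top : HasDegree (⊤ : Ideal (MvPolynomial (Fin 3) k)) 0 := by
  have : Subsingleton (MvPolynomial (Fin 3) k ⧸ (⊤ : Ideal (MvPolynomial (Fin 3) k))) :=
    Ideal.Quotient.subsingleton_iff.2 rfl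
  refine ⟨0, Filter.Eventually.of_forall fun m => ?_, fun h => absurd rfl h, fun _ => ?_⟩
  · rw [hilbertFunction, Module.finrank_zero_of_subsingleton, Polynomial.eval_zero, Nat.cast_zero]
  · rw [Module.finrank_zero_of_subsingleton]

end BourbakiDegree

open MvPolynomial BourbakiDegree in
theorem mainTheorem7 (k : Type*) [Field k] [IsAlgClosed k] (n : ℕ) :
    ∃ (d : ℕ) (F : MvPolynomial (Fin 3) k),
      F.IsHomogeneous (d + 1) ∧ Squarefree F ∧ ¬ ringChar k ∣ d + 1 ∧
        BourbakiDegree.HasBourbakiDegree d F n := by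
  rcases n with _ | r
  · refine ⟨0, X 0, isHomogeneous_X _ _, X_prime.squarefree, ?_, ⟨⊤, isBourbakiIdeal_line⟩, ?_⟩
    · rw [← ringChar.spec]
      simp
    · intro I hI
      rw [eq_top_of_isBourbakiIdeal_line hI]
      exact hasDegree_top
  · obtain ⟨a, b, ha, hV⟩ := exists_isSeparableBinaryForm k r
    obtain ⟨c, m, h⟩ := exists_isAdmissible hV
    refine ⟨c + (m + 1) * (r + 1), binaryCurve c m (r + 1) (binaryForm a b r),
      h.isHomogeneous_binaryCurve, h.squarefree_binaryCurve, ?_, ⟨_, h.isBourbakiIdeal⟩, ?_⟩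
    · rw [← ringChar.spec]
      exact h.degree_ne_zero
    · intro I hI
      rw [h.eq_of_isBourbakiIdeal hI]
      exact hasDegree_span_binaryForm ha
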